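/- Let $n,m\ge 1$ be integers and $1\le p_0<\infty$. Cubes in $\mathbb R^n$ are half-open with sides parallel to the axes, $2^kQ$ is the cube concentric with $Q$ with side length multiplied by $2^k$, and $\langle f\rangle_{Q,p_0}=\big(\frac1{|Q|}\int_Q|f|^{p_0}\big)^{1/p_0}\in[0,\infty]$. A dyadic grid is a collection of cubes with side lengths $2^j$, $j\in\mathbb Z$, any two of which are nested or disjoint, and such that for each $j\in\mathbb Z$ its cubes of side length $2^j$ partition $\mathbb R^n$. A sparse family is a subfamily $\mathcal S$ of some dyadic grid for which there are pairwise disjoint measurable sets $E_Q\subset Q$, $Q\in\mathcal S$, with $|Q|\le 2|E_Q|$. For a sparse family $\mathcal S$, an integer $k\ge 0$ and an $m$-tuple $\vec f=(f_1,\dots,f_m)$ of measurable functions on $\mathbb R^n$, put $$\mathcal T^{k,p_0}_{\mathcal S}(\vec f)=\sum_{Q\in\mathcal S}\Big[\prod_{i=1}^m\langle f_i\rangle_{2^kQ,p_0}\Big]\chi_Q,\qquad \mathcal A^{0,p_0}_{\mathcal S}(\vec f)=\sum_{Q\in\mathcal S}\Big[\prod_{i=1}^m\langle f_i\rangle_{Q,p_0}\Big]\chi_Q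 .$$ Let $\mathbb X$ be a quasi-Banach function space on $\mathbb R^n$ with Lebesgue measure, that is, a complete quasi-normed space of measurable functions (identified if equal a.e.) such that $|g|\le|h|$ a.e. and $h\in\mathbb X$ imply $g\in\mathbb X$ and $\|g\|_{\mathbb X}\le\|h\|_{\mathbb X}$; as usual $\|g\|_{\mathbb X}=\infty$ if $g\notin\mathbb X$. Then there is a constant $C>0$, depending only on $n$, $m$, $p_0$ and $\mathbb X$, such that for every integer $k\ge0$, every sparse family $\mathcal S$ and every $m$-tuple $\vec f$ of measurable functions there is a sparse family $\mathcal S'$ (which may depend on $k$, $\mathcal S$, $\vec f$ and $\mathbb X$, and may lie in another dyadic grid) with $$\|\mathcal T^{k,p_0}_{\mathcal S}(\vec f)\|_{\mathbb X}\le C(k+1)\,\|\mathcal A^{0,p_0}_{\mathcal S'}(\vec f)\|_{\mathbb X}.$$ -/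

import Mathlib

open MeasureTheory Set Filter Topology
open scoped ENNReal NNReal

/-- An axis-parallel cube in `ℝⁿ`, given by its lower corner and its side length. -/
structure Cube (n : ℕ) where
  corner : Fin n → ℝ
  side : ℝ
  side_pos : 0 < side

namespace Cube

variable {n : ℕ}

/-- The half-open set of points of the cube. -/
def toSet (Q : Cube n) : Set (Fin n → ℝ) :=
  {x | ∀ i, Q.corner i ≤ x i ∧ x i < Q.corner i + Q.side}

/-- The concentric dilate `2 ^ k Q` (same centre, side length `2 ^ k` times as long). -/
noncomputable def dilate (k : ℕ) (Q : Cube n) : Cube n where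
  corner i := Q.corner i - (2 ^ k - 1) / 2 * Q.side
  side := 2 ^ k * Q.side
  side_pos := mul_pos (by positivity) Q.side_pos

end Cube

/-- A general dyadic grid in `ℝⁿ`: side lengths are integer powers of two, any two cubes are
nested or disjoint, and for every `j : ℤ` the cubes of side length `2 ^ j` partition `ℝⁿ`. -/
structure IsDyadicGrid {n : ℕ} (D : Set (Cube n)) : Prop where
  side_eq : ∀ Q ∈ D, ∃ j : ℤ, Q.side = 2 ^ j
  nested : ∀ Q ∈ D, ∀ R ∈ D,
    Q.toSet ⊆ R.toSet ∨ R.toSet ⊆ Q.toSet ∨ Disjoint Q.toSet R.toSet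
  partition : ∀ (j : ℤ) (x : Fin n → ℝ), ∃! Q : Cube n, Q ∈ D ∧ Q.side = 2 ^ j ∧ x ∈ Q.toSet

/-- A sparse family: a family `S` of cubes of some dyadic grid, with pairwise disjoint measurable
sets `E Q ⊆ Q`, `Q ∈ S`, such that `|Q| ≤ 2 |E Q|`. -/
def IsSparseFamily {n : ℕ} (S : Set (Cube n)) : Prop :=
  ∃ D : Set (Cube n), IsDyadicGrid D ∧ S ⊆ D ∧
    ∃ E : Cube n → Set (Fin n → ℝ),
      (∀ Q ∈ S, MeasurableSet (E Q) ∧ E Q ⊆ Q.toSet ∧ volume Q.toSet ≤ 2 * volume (E Q)) ∧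
      S.PairwiseDisjoint E

/-- The `L^{p₀}`-average `⟨f⟩_{Q,p₀} = (|Q|⁻¹ ∫_Q |f|^{p₀})^{1/p₀}`, with values in `[0, ∞]`. -/
noncomputable def cubeAverage {n : ℕ} (p₀ : ℝ) (Q : Cube n) (f : (Fin n → ℝ) → ℂ) : ℝ≥0∞ :=
  ((∫⁻ x in Q.toSet, ‖f x‖ₑ ^ p₀) / volume Q.toSet) ^ (1 / p₀)

/-- The sparse operator
`T^{k,p₀}_S (f₁, …, f_m) = ∑_{Q ∈ S} (∏ᵢ ⟨fᵢ⟩_{2^k Q, p₀}) χ_Q`, with values in `[0, ∞]`. -/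
noncomputable def sparseT {n m : ℕ} (k : ℕ) (p₀ : ℝ) (S : Set (Cube n))
    (f : Fin m → (Fin n → ℝ) → ℂ) (x : Fin n → ℝ) : ℝ≥0∞ :=
  ∑' Q : S, (Q : Cube n).toSet.indicator
    (fun _ => ∏ i, cubeAverage p₀ ((Q : Cube n).dilate k) (f i)) x

/-- The sparse operator
`A^{0,p₀}_S (f₁, …, f_m) = ∑_{Q ∈ S} (∏ᵢ ⟨fᵢ⟩_{Q, p₀}) χ_Q`, with values in `[0, ∞]`. -/
noncomputable def sparseA {n m : ℕ} (p₀ : ℝ) (S : Set (Cube n))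
    (f : Fin m → (Fin n → ℝ) → ℂ) (x : Fin n → ℝ) : ℝ≥0∞ :=
  ∑' Q : S, (Q : Cube n).toSet.indicator (fun _ => ∏ i, cubeAverage p₀ (Q : Cube n) (f i)) x

/-- A quasi-Banach function space over `ℝⁿ` with Lebesgue measure, given by its quasi-norm on
nonnegative measurable functions with values in `[0, ∞]`. The space itself consists of the
measurable `u` with `‖u‖ = qnorm |u| < ∞`; as usual the quasi-norm is `∞` off the space. -/
structure QuasiBanachFunctionSpace (n : ℕ) where
  qnorm : ((Fin n → ℝ) → ℝ≥0∞) → ℝ≥0∞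
  qnorm_eq_zero_iff : ∀ g, Measurable g → (qnorm g = 0 ↔ g =ᵐ[volume] 0)
  qnorm_const_mul : ∀ (c : ℝ≥0) (g), Measurable g → qnorm (fun x => c * g x) = c * qnorm g
  qnorm_add_le : ∃ K : ℝ≥0, ∀ g h, Measurable g → Measurable h →
    qnorm (fun x => g x + h x) ≤ K * (qnorm g + qnorm h)
  qnorm_mono : ∀ g h, Measurable g → Measurable h → g ≤ᵐ[volume] h → qnorm g ≤ qnorm h
  complete : ∀ u : ℕ → (Fin n → ℝ) → ℝ, (∀ j, Measurable (u j)) →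
    (∀ j, qnorm (fun x => ‖u j x‖ₑ) < ∞) →
    (∀ ε : ℝ≥0∞, 0 < ε → ∃ N : ℕ, ∀ i ≥ N, ∀ j ≥ N, qnorm (fun x => ‖u i x - u j x‖ₑ) < ε) →
    ∃ v : (Fin n → ℝ) → ℝ, Measurable v ∧ qnorm (fun x => ‖v x‖ₑ) < ∞ ∧
      Tendsto (fun j => qnorm (fun x => ‖u j x - v x‖ₑ)) atTop (𝓝 0)

/-! The operator is dominated pointwise by finitely many sparse operators, their number depending
only on `n`, with a constant linear in `k`. The quasi-triangle inequality then lets the summand of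
largest quasi-norm stand for all of them.

The one-third trick (`Cube.exists_shiftedGrid`) puts `Q` and `2 ^ k Q` into cubes of one of `3 ^ n`
shifted grids, `k` generations apart. This reduces `sparseT` to positive dyadic shifts: sums of
averages over those cubes whose `k`-th descendant around `x` lies in a Carleson family `A`
(`IsSparseFamily.sparseT_le`).

Such a shift is controlled by stopping cubes. One stops when the mean of some `|f i| ^ p₀`, or the
mean of the overlap function of `A`, becomes too large. Between stops the averages are comparable to
those of the last stopping cube, so only the number of terms matters. `card_stopDepth_eq_le` bounds
it by `4 * L + k`: a bounded number of terms whose descendant precedes the next stop, and at most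
`k` terms whose descendant has passed it.

A dyadic grid has no top cube, so the descent must start somewhere. Above a suitable generation `s
x`, all cubes over `x` belong to a single sparse family (`exists_sparse_large_cubes`), and there the
shift is trivially dominated. -/

/-! ### Geometry of cubes and dyadic grids -/

namespace Cube

variable {n : ℕ}

theorem toSet_eq_pi (Q : Cube n) :
    Q.toSet = Set.pi univ fun i => Ico (Q.corner i) (Q.corner i + Q.side) := by
  ext x; simp [toSet]

theorem measurableSet_toSet (Q : Cube n) : MeasurableSet Q.toSet := by
  rw [toSet_eq_pi]
  exact MeasurableSet.univ_pi fun _ => measurableSet_Ico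

theorem volume_toSet (Q : Cube n) : volume Q.toSet = ENNReal.ofReal Q.side ^ n := by
  rw [toSet_eq_pi, Real.volume_pi_Ico]
  simp

theorem volume_ne_zero (Q : Cube n) : volume Q.toSet ≠ 0 := by
  rw [volume_toSet]
  exact pow_ne_zero _ (by simpa using Q.side_pos)

theorem volume_ne_top (Q : Cube n) : volume Q.toSet ≠ ∞ := by
  rw [volume_toSet]
  exact ENNReal.pow_ne_top ENNReal.ofReal_ne_top

theorem side_le_of_subset (hn : n ≠ 0) {Q R : Cube n} (h : Q.toSet ⊆ R.toSet) :
    Q.side ≤ R.side := by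
  have h1 := measure_mono (μ := volume) h
  rw [volume_toSet, volume_toSet, ENNReal.pow_le_pow_left_iff hn] at h1
  exact (ENNReal.ofReal_le_ofReal_iff R.side_pos.le).1 h1

theorem exists_mem_of_dense {s : Set (Fin n → ℝ)} (hs : Dense s) (Q : Cube n) :
    ∃ x ∈ s, x ∈ Q.toSet := by
  have ho : IsOpen (Set.pi univ fun i => Ioo (Q.corner i) (Q.corner i + Q.side)) :=
    isOpen_set_pi finite_univ fun _ _ => isOpen_Ioo
  have hne : (Set.pi univ fun i => Ioo (Q.corner i) (Q.corner i + Q.side)).Nonempty := by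
    refine ⟨fun i => Q.corner i + Q.side / 2, fun i _ => ?_⟩
    have := Q.side_pos
    constructor <;> linarith
  obtain ⟨x, hx, hxs⟩ := hs.inter_open_nonempty _ ho hne
  exact ⟨x, hxs, fun i => ⟨(hx i trivial).1.le, (hx i trivial).2⟩⟩

theorem nonempty_toSet (Q : Cube n) : Q.toSet.Nonempty := by
  obtain ⟨x, -, hx⟩ := exists_mem_of_dense dense_univ Q
  exact ⟨x, hx⟩

theorem dilate_side (k : ℕ) (Q : Cube n) : (Q.dilate k).side = 2 ^ k * Q.side := rfl

theorem subset_dilate (k : ℕ) (Q : Cube n) : Q.toSet ⊆ (Q.dilate k).toSet := by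
  intro x hx i
  have h1 : (1 : ℝ) ≤ 2 ^ k := one_le_pow₀ (by norm_num)
  have h2 := mul_nonneg (sub_nonneg.2 h1) Q.side_pos.le
  obtain ⟨h3, h4⟩ := hx i
  simp only [dilate]
  constructor <;> nlinarith

end Cube

namespace IsDyadicGrid

variable {n : ℕ} {D : Set (Cube n)}

/-- The cube of side length `2 ^ j` of the grid that contains `x`. -/
noncomputable def cell (hD : IsDyadicGrid D) (j : ℤ) (x : Fin n → ℝ) : Cube n :=
  (hD.partition j x).choose

variable (hD : IsDyadicGrid D)

theorem cell_mem (j : ℤ) (x : Fin n → ℝ) : hD.cell j x ∈ D :=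
  (hD.partition j x).choose_spec.1.1

theorem cell_side (j : ℤ) (x : Fin n → ℝ) : (hD.cell j x).side = 2 ^ j :=
  (hD.partition j x).choose_spec.1.2.1

theorem mem_cell (j : ℤ) (x : Fin n → ℝ) : x ∈ (hD.cell j x).toSet :=
  (hD.partition j x).choose_spec.1.2.2

theorem eq_cell {j : ℤ} {x : Fin n → ℝ} {Q : Cube n} (hQ : Q ∈ D) (hj : Q.side = 2 ^ j)
    (hx : x ∈ Q.toSet) : Q = hD.cell j x :=
  (hD.partition j x).choose_spec.2 Q ⟨hQ, hj, hx⟩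

theorem exists_eq_cell {x : Fin n → ℝ} {Q : Cube n} (hQ : Q ∈ D) (hx : x ∈ Q.toSet) :
    ∃ j, Q = hD.cell j x := by
  obtain ⟨j, hj⟩ := hD.side_eq Q hQ
  exact ⟨j, hD.eq_cell hQ hj hx⟩

theorem cell_eq_cell {j : ℤ} {x y : Fin n → ℝ} (hy : y ∈ (hD.cell j x).toSet) :
    hD.cell j y = hD.cell j x :=
  (hD.eq_cell (hD.cell_mem j x) (hD.cell_side j x) hy).symm

theorem cell_injective (x : Fin n → ℝ) : Function.Injective fun j => hD.cell j x := by
  intro i j h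
  have h1 : (hD.cell i x).side = (hD.cell j x).side := congrArg Cube.side h
  rw [cell_side, cell_side] at h1
  exact zpow_right_injective₀ (by norm_num) (by norm_num) h1

theorem le_of_cell_subset (hn : n ≠ 0) {i j : ℤ} {x y : Fin n → ℝ}
    (h : (hD.cell i x).toSet ⊆ (hD.cell j y).toSet) : i ≤ j := by
  have h1 := Cube.side_le_of_subset hn h
  rw [cell_side, cell_side] at h1
  exact (zpow_le_zpow_iff_right₀ (by norm_num)).1 h1

theorem cell_mono (hn : n ≠ 0) {i j : ℤ} (hij : i ≤ j) (x : Fin n → ℝ) :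
    (hD.cell i x).toSet ⊆ (hD.cell j x).toSet := by
  rcases hD.nested _ (hD.cell_mem i x) _ (hD.cell_mem j x) with h | h | h
  · exact h
  · rw [le_antisymm hij (hD.le_of_cell_subset hn h)]
  · exact absurd (hD.mem_cell j x) (Set.disjoint_left.1 h (hD.mem_cell i x))

theorem cell_eq_cell_of_le (hn : n ≠ 0) {i j : ℤ} (hij : i ≤ j) {x y : Fin n → ℝ}
    (hy : y ∈ (hD.cell i x).toSet) : hD.cell j y = hD.cell j x :=
  hD.cell_eq_cell (hD.cell_mono hn hij x hy)

include hD in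
theorem countable : D.Countable := by
  obtain ⟨s, hs, hd⟩ := TopologicalSpace.exists_countable_dense (Fin n → ℝ)
  have : D ⊆ (fun a : ℤ × (Fin n → ℝ) => hD.cell a.1 a.2) '' (univ ×ˢ s) := by
    intro Q hQ
    obtain ⟨x, hxs, hx⟩ := Cube.exists_mem_of_dense hd Q
    obtain ⟨j, hj⟩ := hD.exists_eq_cell hQ hx
    exact ⟨(j, x), ⟨trivial, hxs⟩, hj.symm⟩
  exact ((countable_univ.prod hs).image _).mono this

end IsDyadicGrid

theorem IsSparseFamily.countable {n : ℕ} {S : Set (Cube n)} (hS : IsSparseFamily S) :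
    S.Countable := by
  obtain ⟨D, hD, hSD, -⟩ := hS
  exact hD.countable.mono hSD

theorem measurable_tsum_indicator {n : ℕ} {S : Set (Cube n)} (hS : S.Countable)
    (c : Cube n → ℝ≥0∞) :
    Measurable fun x => ∑' Q : S, (Q : Cube n).toSet.indicator (fun _ => c Q) x := by
  have := hS.to_subtype
  exact Measurable.tsum fun Q => measurable_const.indicator (Q : Cube n).measurableSet_toSet

/-! ### Averages over cubes and the weak-type maximal estimate -/

/-- The average of a `[0, ∞]`-valued function over a cube. -/
noncomputable def Cube.mean {n : ℕ} (Q : Cube n) (g : (Fin n → ℝ) → ℝ≥0∞) : ℝ≥0∞ :=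
  (∫⁻ x in Q.toSet, g x) / volume Q.toSet

namespace Cube

variable {n : ℕ} {g : (Fin n → ℝ) → ℝ≥0∞}

theorem mean_mul_volume (Q : Cube n) : Q.mean g * volume Q.toSet = ∫⁻ x in Q.toSet, g x :=
  ENNReal.div_mul_cancel Q.volume_ne_zero Q.volume_ne_top

theorem mean_le_mean_of_subset {Q R : Cube n} (h : Q.toSet ⊆ R.toSet) {c : ℝ} (hc : 0 < c)
    (hs : R.side = c * Q.side) : Q.mean g ≤ ENNReal.ofReal c ^ n * R.mean g := by
  have hv : volume R.toSet = ENNReal.ofReal c ^ n * volume Q.toSet := by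
    rw [volume_toSet, volume_toSet, hs, ENNReal.ofReal_mul hc.le, mul_pow]
  have hc0 : ENNReal.ofReal c ^ n ≠ 0 := pow_ne_zero _ (by simpa using hc)
  rw [mean, ENNReal.div_le_iff Q.volume_ne_zero Q.volume_ne_top, mul_right_comm, ← hv, mul_comm,
    mean_mul_volume]
  exact lintegral_mono_set h

end Cube

namespace IsDyadicGrid

variable {n : ℕ} {D : Set (Cube n)} (hD : IsDyadicGrid D)

include hD

theorem exists_maximal_cube (hn : n ≠ 0) {P : Cube n} {G : Set (Cube n)} (hG : G ⊆ D)
    (hP : ∀ Q ∈ G, Q.toSet ⊆ P.toSet) {Q : Cube n} (hQ : Q ∈ G) {x : Fin n → ℝ}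
    (hx : x ∈ Q.toSet) :
    ∃ R ∈ G, x ∈ R.toSet ∧ ∀ T ∈ G, R.toSet ⊆ T.toSet → T = R := by
  obtain ⟨b, hb⟩ := pow_unbounded_of_one_lt P.side (one_lt_two : (1 : ℝ) < 2)
  obtain ⟨j, hj⟩ := hD.exists_eq_cell (hG hQ) hx
  obtain ⟨i, hi, hmax⟩ := Int.exists_greatest_of_bdd (P := fun i => hD.cell i x ∈ G)
    ⟨(b : ℤ), fun i hi => by
      have h1 := Cube.side_le_of_subset hn (hP _ hi)
      rw [cell_side] at h1
      have h2 : (2 : ℝ) ^ i ≤ 2 ^ (b : ℤ) := by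
        rw [zpow_natCast]; exact h1.trans hb.le
      exact (zpow_le_zpow_iff_right₀ (by norm_num)).1 h2⟩ ⟨j, hj ▸ hQ⟩
  refine ⟨hD.cell i x, hi, hD.mem_cell i x, fun T hT hsub => ?_⟩
  obtain ⟨l, rfl⟩ := hD.exists_eq_cell (hG hT) (hsub (hD.mem_cell i x))
  rw [le_antisymm (hmax l hT) (hD.le_of_cell_subset hn hsub)]

/-- The weak-type estimate for the dyadic maximal function, in terms of families of cubes. -/
theorem mul_volume_biUnion_le (hn : n ≠ 0) {P : Cube n} {G : Set (Cube n)} (hG : G ⊆ D)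
    (hP : ∀ Q ∈ G, Q.toSet ⊆ P.toSet) {g : (Fin n → ℝ) → ℝ≥0∞} {c : ℝ≥0∞}
    (hc : ∀ Q ∈ G, c ≤ Q.mean g) :
    c * volume (⋃ Q ∈ G, Q.toSet) ≤ ∫⁻ x in P.toSet, g x := by
  set M : Set (Cube n) := {R ∈ G | ∀ T ∈ G, R.toSet ⊆ T.toSet → T = R} with hM
  have hMG : M ⊆ G := sep_subset _ _
  have hMc : M.Countable := hD.countable.mono (hMG.trans hG)
  have hcov : (⋃ Q ∈ G, Q.toSet) ⊆ ⋃ Q ∈ M, Q.toSet := by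
    intro x hx
    simp only [mem_iUnion, exists_prop] at hx ⊢
    obtain ⟨Q, hQ, hx⟩ := hx
    obtain ⟨R, hR, hxR, hmax⟩ := hD.exists_maximal_cube hn hG hP hQ hx
    exact ⟨R, ⟨hR, hmax⟩, hxR⟩
  have hdisj : M.PairwiseDisjoint Cube.toSet := by
    intro Q hQ R hR hne
    rcases hD.nested Q (hG hQ.1) R (hG hR.1) with h | h | h
    · exact absurd (hQ.2 R hR.1 h).symm hne
    · exact absurd (hR.2 Q hQ.1 h) hne
    · exact h
  have := hMc.to_subtype
  calc c * volume (⋃ Q ∈ G, Q.toSet) ≤ c * ∑' Q : M, volume (Q : Cube n).toSet := by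
        gcongr
        exact (measure_mono hcov).trans (measure_biUnion_le _ hMc _)
    _ = ∑' Q : M, c * volume (Q : Cube n).toSet := ENNReal.tsum_mul_left.symm
    _ ≤ ∑' Q : M, ∫⁻ x in (Q : Cube n).toSet, g x := by
        refine ENNReal.tsum_le_tsum fun Q => ?_
        rw [← Cube.mean_mul_volume]
        gcongr
        exact hc Q (hMG Q.2)
    _ = ∫⁻ x in ⋃ Q ∈ M, Q.toSet, g x :=
        (lintegral_biUnion hMc (fun Q _ => Q.measurableSet_toSet) hdisj g).symm
    _ ≤ ∫⁻ x in P.toSet, g x :=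
        lintegral_mono_set (iUnion₂_subset fun Q hQ => hP Q (hMG hQ))

theorem mul_volume_setOf_mean_lt_le (hn : n ≠ 0) (P : Cube n) (g : (Fin n → ℝ) → ℝ≥0∞)
    {K : ℝ≥0∞} (hK : K ≠ 0) :
    K * volume (⋃ Q ∈ {Q | Q ∈ D ∧ Q.toSet ⊆ P.toSet ∧ K * P.mean g < Q.mean g}, Q.toSet)
      ≤ volume P.toSet := by
  have key := hD.mul_volume_biUnion_le hn (P := P) (g := g) (c := K * P.mean g)
    (G := {Q | Q ∈ D ∧ Q.toSet ⊆ P.toSet ∧ K * P.mean g < Q.mean g})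
    (fun Q hQ => hQ.1) (fun Q hQ => hQ.2.1) (fun Q hQ => hQ.2.2.le)
  -- The mean over `P` can be cancelled only if it is neither `0` nor `∞`. In these two cases the
  -- strict inequality leaves no cube in the family.
  by_cases h0 : P.mean g = 0
  · have : {Q | Q ∈ D ∧ Q.toSet ⊆ P.toSet ∧ K * P.mean g < Q.mean g} = ∅ := by
      rw [eq_empty_iff_forall_notMem]
      rintro Q ⟨-, hQ, hlt⟩
      have h1 : ∫⁻ x in P.toSet, g x = 0 := by rw [← Cube.mean_mul_volume, h0, zero_mul]
      have h2 : ∫⁻ x in Q.toSet, g x = 0 := le_antisymm (h1 ▸ lintegral_mono_set hQ) zero_le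
      simp [Cube.mean, h2] at hlt
    simp [this]
  by_cases h1 : P.mean g = ∞
  · have : {Q | Q ∈ D ∧ Q.toSet ⊆ P.toSet ∧ K * P.mean g < Q.mean g} = ∅ := by
      rw [eq_empty_iff_forall_notMem]
      rintro Q ⟨-, hQ, hlt⟩
      simp [h1, ENNReal.mul_top hK] at hlt
    simp [this]
  rw [← Cube.mean_mul_volume, mul_comm K, mul_assoc, ENNReal.mul_le_mul_iff_right h0 h1,
    mul_comm (P.mean g) K] at key
  exact key

end IsDyadicGrid

/-! ### Carleson families and stopping cubes -/

/-- The number of cubes of `A` inside `P` that contain a given point. -/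
noncomputable def overlap {n : ℕ} (A : Set (Cube n)) (P : Cube n) (x : Fin n → ℝ) : ℝ≥0∞ :=
  ∑' Q : {Q : Cube n | Q ∈ A ∧ Q.toSet ⊆ P.toSet}, (Q : Cube n).toSet.indicator (fun _ => 1) x

/-- The Carleson packing condition with constant `L`, tested on the cubes of `D`. -/
def IsCarleson {n : ℕ} (D A : Set (Cube n)) (L : ℝ≥0∞) : Prop :=
  ∀ P ∈ D, ∑' Q : {Q : Cube n | Q ∈ A ∧ Q.toSet ⊆ P.toSet}, volume (Q : Cube n).toSet
    ≤ L * volume P.toSet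

theorem IsCarleson.mean_overlap_le {n : ℕ} {D A : Set (Cube n)} {L : ℝ≥0∞}
    (h : IsCarleson D A L) (hA : A.Countable) {P : Cube n} (hP : P ∈ D) :
    P.mean (overlap A P) ≤ L := by
  have : Countable {Q : Cube n | Q ∈ A ∧ Q.toSet ⊆ P.toSet} := (hA.mono fun Q hQ => hQ.1).to_subtype
  rw [Cube.mean, ENNReal.div_le_iff P.volume_ne_zero P.volume_ne_top]
  refine le_trans ?_ (h P hP)
  unfold overlap
  rw [lintegral_tsum fun Q : {Q : Cube n | Q ∈ A ∧ Q.toSet ⊆ P.toSet} =>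
    (measurable_const.indicator (Q : Cube n).measurableSet_toSet).aemeasurable]
  refine ENNReal.tsum_le_tsum fun Q => ?_
  rw [lintegral_indicator_const (Q : Cube n).measurableSet_toSet, one_mul]
  exact Measure.restrict_apply_le _ _

/-- The stopping condition: on `Q`, the mean of some `g i` is much larger than on `P`, or the mean
of the overlap function of `A` below `P` is large. -/
def Exceeds {n m : ℕ} (g : Fin m → (Fin n → ℝ) → ℝ≥0∞) (A : Set (Cube n)) (L : ℝ≥0∞)
    (P Q : Cube n) : Prop :=
  (∃ i, 4 * (m : ℝ≥0∞) * P.mean (g i) < Q.mean (g i)) ∨ 4 * L < Q.mean (overlap A P)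

namespace IsDyadicGrid

variable {n : ℕ} {D : Set (Cube n)} (hD : IsDyadicGrid D)

-- The thresholds are chosen to leave half of `P`: by the weak-type estimate each of the `m`
-- functions costs at most `1 / (4 m)` of its volume, and the overlap function, whose mean over `P`
-- is at most `L`, costs at most `1 / 4`.
include hD in
theorem volume_biUnion_exceeds_le (hn : n ≠ 0) {m : ℕ} (g : Fin m → (Fin n → ℝ) → ℝ≥0∞)
    {A : Set (Cube n)} (hAD : A ⊆ D) {L : ℝ≥0∞} (hA : IsCarleson D A L)
    {P : Cube n} (hP : P ∈ D) :
    2 * volume (⋃ Q ∈ {Q | Q ∈ D ∧ Q.toSet ⊆ P.toSet ∧ Exceeds g A L P Q}, Q.toSet)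
      ≤ volume P.toSet := by
  set U : Fin m → Set (Fin n → ℝ) := fun i => ⋃ Q ∈ {Q | Q ∈ D ∧ Q.toSet ⊆ P.toSet ∧
    4 * (m : ℝ≥0∞) * P.mean (g i) < Q.mean (g i)}, Q.toSet with hU
  set V : Set (Fin n → ℝ) := ⋃ Q ∈ {Q | Q ∈ D ∧ Q.toSet ⊆ P.toSet ∧
    4 * P.mean (overlap A P) < Q.mean (overlap A P)}, Q.toSet with hV
  have hsub : (⋃ Q ∈ {Q | Q ∈ D ∧ Q.toSet ⊆ P.toSet ∧ Exceeds g A L P Q}, Q.toSet)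
      ⊆ (⋃ i, U i) ∪ V := by
    refine iUnion₂_subset fun Q hQ => ?_
    obtain ⟨hQD, hQP, ⟨i, hi⟩ | hlt⟩ := hQ
    · refine subset_union_of_subset_left (subset_iUnion_of_subset i ?_) _
      exact subset_biUnion_of_mem (u := Cube.toSet) (show Q ∈ {Q | _} from ⟨hQD, hQP, hi⟩)
    · refine subset_union_of_subset_right ?_ _
      refine subset_biUnion_of_mem (u := Cube.toSet) (show Q ∈ {Q | _} from ⟨hQD, hQP, ?_⟩)
      refine lt_of_le_of_lt ?_ hlt
      gcongr
      exact hA.mean_overlap_le (hD.countable.mono hAD) hP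
  have hVle : 4 * volume V ≤ volume P.toSet :=
    hD.mul_volume_setOf_mean_lt_le hn P (overlap A P) (by norm_num)
  have hUle : 4 * volume (⋃ i, U i) ≤ volume P.toSet := by
    rcases Nat.eq_zero_or_pos m with rfl | hm
    · simp
    have hm0 : (m : ℝ≥0∞) ≠ 0 := by exact_mod_cast hm.ne'
    have hmt : (m : ℝ≥0∞) ≠ ∞ := ENNReal.natCast_ne_top m
    have h1 : ∀ i, 4 * (m : ℝ≥0∞) * volume (U i) ≤ volume P.toSet := fun i =>
      hD.mul_volume_setOf_mean_lt_le hn P (g i) (mul_ne_zero (by norm_num) hm0)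
    have h2 : (m : ℝ≥0∞) * (4 * volume (⋃ i, U i)) ≤ m * volume P.toSet := by
      calc (m : ℝ≥0∞) * (4 * volume (⋃ i, U i)) ≤ m * (4 * ∑ i, volume (U i)) := by
            gcongr
            exact measure_iUnion_fintype_le _ _
        _ = ∑ i, 4 * (m : ℝ≥0∞) * volume (U i) := by
            rw [← Finset.mul_sum]; ring
        _ ≤ ∑ _i : Fin m, volume P.toSet := Finset.sum_le_sum fun i _ => h1 i
        _ = m * volume P.toSet := by simp
    exact (ENNReal.mul_le_mul_iff_right hm0 hmt).1 h2
  have h3 : (2 : ℝ≥0∞) * (2 * volume (⋃ Q ∈ {Q | Q ∈ D ∧ Q.toSet ⊆ P.toSet ∧ Exceeds g A L P Q},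
      Q.toSet)) ≤ 2 * volume P.toSet := by
    calc _ = 4 * volume (⋃ Q ∈ {Q | Q ∈ D ∧ Q.toSet ⊆ P.toSet ∧ Exceeds g A L P Q}, Q.toSet) := by
          rw [← mul_assoc]; norm_num
      _ ≤ 4 * (volume (⋃ i, U i) + volume V) := by
          gcongr
          exact (measure_mono hsub).trans (measure_union_le _ _)
      _ = 4 * volume (⋃ i, U i) + 4 * volume V := mul_add _ _ _
      _ ≤ 2 * volume P.toSet := by rw [two_mul]; exact add_le_add hUle hVle
  exact (ENNReal.mul_le_mul_iff_right two_ne_zero ENNReal.ofNat_ne_top).1 h3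

open Classical in
/-- Descending from the cube of generation `s x` to `x`, the depth of the last stopping cube
met in `d` steps; `B P Q` means that one stops at `Q` if the last stopping cube is `P`. -/
noncomputable def stopDepth (B : Cube n → Cube n → Prop) (s : (Fin n → ℝ) → ℤ)
    (x : Fin n → ℝ) : ℕ → ℕ
  | 0 => 0
  | d + 1 =>
    if B (hD.cell (s x - stopDepth B s x d) x) (hD.cell (s x - (d + 1 : ℕ)) x) then d + 1
    else stopDepth B s x d

/-- The family of all stopping cubes. -/
def stopFamily (B : Cube n → Cube n → Prop) (s : (Fin n → ℝ) → ℤ) : Set (Cube n) :=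
  {Q | ∃ x d, Q = hD.cell (s x - hD.stopDepth B s x d) x}

section stopDepth

variable (B : Cube n → Cube n → Prop) (s : (Fin n → ℝ) → ℤ) (x : Fin n → ℝ)

theorem stopDepth_le (d : ℕ) : hD.stopDepth B s x d ≤ d := by
  induction d with
  | zero => simp [stopDepth]
  | succ d ih =>
    rw [stopDepth]
    split_ifs
    · exact le_rfl
    · omega

theorem stopDepth_mono : Monotone (hD.stopDepth B s x) := by
  refine monotone_nat_of_le_succ fun d => ?_
  have := hD.stopDepth_le B s x d
  rw [stopDepth]
  split_ifs
  · omega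
  · exact le_rfl

theorem stopDepth_stopDepth (d : ℕ) :
    hD.stopDepth B s x (hD.stopDepth B s x d) = hD.stopDepth B s x d := by
  induction d with
  | zero => simp [stopDepth]
  | succ d ih =>
    by_cases h : B (hD.cell (s x - hD.stopDepth B s x d) x) (hD.cell (s x - (d + 1 : ℕ)) x)
    · have : hD.stopDepth B s x (d + 1) = d + 1 := by rw [stopDepth, if_pos h]
      rw [this, this]
    · have : hD.stopDepth B s x (d + 1) = hD.stopDepth B s x d := by rw [stopDepth, if_neg h]
      rw [this, ih]

theorem not_of_stopDepth_lt {d : ℕ} (h : hD.stopDepth B s x d < d) :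
    ¬ B (hD.cell (s x - hD.stopDepth B s x d) x) (hD.cell (s x - d) x) := by
  cases d with
  | zero => omega
  | succ d =>
    rw [stopDepth] at h ⊢
    split_ifs at h ⊢ with hB
    · omega
    · exact hB

/-- Up to depth `d` the recursion sees only cubes containing the cube of depth `d`, and these are
the same for all its points. Hence being a stopping cube is a property of the cube and not of the
point used to reach it. -/
theorem stopDepth_congr (hn : n ≠ 0) (hs : ∀ x, ∀ y ∈ (hD.cell (s x) x).toSet, s y = s x)
    {x y : Fin n → ℝ} {d : ℕ} (hy : y ∈ (hD.cell (s x - d) x).toSet) {e : ℕ} (he : e ≤ d) :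
    hD.stopDepth B s y e = hD.stopDepth B s x e := by
  have hsy : s y = s x := hs x y (hD.cell_mono hn (by omega) x hy)
  induction e with
  | zero => simp [stopDepth]
  | succ e ih =>
    have ih := ih (by omega)
    have h1 := hD.stopDepth_le B s x e
    rw [stopDepth, stopDepth, ih, hsy,
      hD.cell_eq_cell_of_le hn (show s x - d ≤ s x - hD.stopDepth B s x e by omega) hy,
      hD.cell_eq_cell_of_le hn (show s x - d ≤ s x - (e + 1 : ℕ) by omega) hy]

theorem stopDepth_eq_of_forall_not {a : ℕ} (ha : hD.stopDepth B s x a = a)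
    (h : ∀ e : ℕ, a ≤ e → ¬ B (hD.cell (s x - a) x) (hD.cell (s x - e) x)) {d : ℕ} (hd : a ≤ d) :
    hD.stopDepth B s x d = a := by
  induction d, hd using Nat.le_induction with
  | base => exact ha
  | succ d hd ih => rw [stopDepth, ih, if_neg (h (d + 1) (by omega))]

theorem stopFamily_subset : hD.stopFamily B s ⊆ D := by
  rintro _ ⟨x, d, rfl⟩
  exact hD.cell_mem _ _

/-- The set attached to `P` is `P` minus all its subcubes that would trigger a stop. For a point of
this set the descent never stops again after `P`, so no smaller stopping cube contains the point;
this gives disjointness. -/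
theorem isSparseFamily_stopFamily (hn : n ≠ 0)
    (hs : ∀ x, ∀ y ∈ (hD.cell (s x) x).toSet, s y = s x)
    (hB : ∀ P ∈ D, 2 * volume (⋃ Q ∈ {Q | Q ∈ D ∧ Q.toSet ⊆ P.toSet ∧ B P Q}, Q.toSet)
      ≤ volume P.toSet) :
    IsSparseFamily (hD.stopFamily B s) := by
  set U : Cube n → Set (Fin n → ℝ) := fun P =>
    ⋃ Q ∈ {Q | Q ∈ D ∧ Q.toSet ⊆ P.toSet ∧ B P Q}, Q.toSet with hU
  refine ⟨D, hD, hD.stopFamily_subset B s, fun P => P.toSet \ U P, fun P hP => ⟨?_, sdiff_subset, ?_⟩,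
    ?_⟩
  · refine P.measurableSet_toSet.diff (MeasurableSet.biUnion ?_ fun Q _ => Q.measurableSet_toSet)
    exact hD.countable.mono fun Q hQ => hQ.1
  · have h1 := hB P (hD.stopFamily_subset B s hP)
    have h2 : volume P.toSet ≤ volume (P.toSet \ U P) + volume (U P) :=
      (measure_mono fun x hx => by by_cases h : x ∈ U P <;> simp [h, hx]).trans
        (measure_union_le _ _)
    have h3 : volume P.toSet + volume P.toSet
        ≤ 2 * volume (P.toSet \ U P) + volume P.toSet := by
      calc volume P.toSet + volume P.toSet
          ≤ (volume (P.toSet \ U P) + volume (U P)) + (volume (P.toSet \ U P) + volume (U P)) :=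
            add_le_add h2 h2
        _ = 2 * volume (P.toSet \ U P) + 2 * volume (U P) := by ring
        _ ≤ _ := by gcongr
    exact (ENNReal.add_le_add_iff_right P.volume_ne_top).1 h3
  · have key : ∀ P ∈ hD.stopFamily B s, ∀ y ∈ P.toSet, ∃ a : ℕ, hD.stopDepth B s y a = a ∧
        P = hD.cell (s y - a) y := by
      rintro _ ⟨x, d, rfl⟩ y hy
      refine ⟨hD.stopDepth B s x d, ?_, ?_⟩
      · rw [hD.stopDepth_congr B s hn hs hy le_rfl, stopDepth_stopDepth]
      · rw [hs x y (hD.cell_mono hn (by omega) x hy), hD.cell_eq_cell hy]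
    have main : ∀ y, ∀ a b : ℕ, hD.stopDepth B s y a = a → hD.stopDepth B s y b = b → a ≤ b →
        y ∉ U (hD.cell (s y - a) y) → a = b := by
      intro y a b ha hb hab hyU
      rw [← hb]
      refine (hD.stopDepth_eq_of_forall_not B s y ha (fun e he hBe => hyU ?_) hab).symm
      simp only [hU, mem_iUnion, exists_prop]
      exact ⟨_, ⟨hD.cell_mem _ y, hD.cell_mono hn (by omega) y, hBe⟩, hD.mem_cell (s y - e) y⟩
    intro P hP R hR hne
    refine Set.disjoint_left.2 fun y hyP hyR => hne ?_
    obtain ⟨a, ha, hPa⟩ := key P hP y hyP.1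
    obtain ⟨b, hb, hRb⟩ := key R hR y hyR.1
    subst hPa hRb
    rcases le_total a b with hab | hab
    · rw [main y a b ha hb hab hyP.2]
    · rw [main y b a hb ha hab hyR.2]

end stopDepth

end IsDyadicGrid

/-- The product of the averages of the functions `f i` over a cube. -/
noncomputable def Cube.prodAverage {n m : ℕ} (p₀ : ℝ) (f : Fin m → (Fin n → ℝ) → ℂ)
    (Q : Cube n) : ℝ≥0∞ :=
  ∏ i, cubeAverage p₀ Q (f i)

theorem Cube.prodAverage_le {n m : ℕ} {p₀ : ℝ} (hp₀ : 0 ≤ p₀) (f : Fin m → (Fin n → ℝ) → ℂ)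
    {P Q : Cube n} {c : ℝ≥0∞}
    (h : ∀ i, Q.mean (fun x => ‖f i x‖ₑ ^ p₀) ≤ c * P.mean (fun x => ‖f i x‖ₑ ^ p₀)) :
    Q.prodAverage p₀ f ≤ (c ^ (1 / p₀)) ^ m * P.prodAverage p₀ f := by
  have hp : 0 ≤ 1 / p₀ := by positivity
  calc Q.prodAverage p₀ f ≤ ∏ i, c ^ (1 / p₀) * cubeAverage p₀ P (f i) := by
        refine Finset.prod_le_prod' fun i _ => ?_
        rw [cubeAverage, cubeAverage, ← ENNReal.mul_rpow_of_nonneg _ _ hp]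
        exact ENNReal.rpow_le_rpow (h i) hp
    _ = _ := by rw [Finset.prod_mul_distrib]; simp [Cube.prodAverage]

/-! ### Domination of dyadic shifts below a starting generation -/

namespace IsDyadicGrid

variable {n : ℕ} {D : Set (Cube n)} (hD : IsDyadicGrid D)

/-- All the counted cubes contain the cube of generation `j`, so the overlap function is at least
their number on that whole cube. A count at one point thus becomes a mean, which the stopping
condition controls. -/
theorem card_le_mean_overlap (hn : n ≠ 0) {A : Set (Cube n)} {P : Cube n} {x : Fin n → ℝ} {j : ℤ}
    (F : Finset ℤ) (hF : ∀ i ∈ F, j ≤ i ∧ hD.cell i x ∈ A ∧ (hD.cell i x).toSet ⊆ P.toSet) :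
    (F.card : ℝ≥0∞) ≤ (hD.cell j x).mean (overlap A P) := by
  have h1 : ∀ y ∈ (hD.cell j x).toSet, (F.card : ℝ≥0∞) ≤ overlap A P y := by
    intro y hy
    let φ : F → {Q : Cube n | Q ∈ A ∧ Q.toSet ⊆ P.toSet} := fun i =>
      ⟨hD.cell i x, (hF i i.2).2⟩
    have hφ : Function.Injective φ := fun a b hab =>
      Subtype.ext (hD.cell_injective x (congrArg Subtype.val hab))
    calc (F.card : ℝ≥0∞) = ∑' i : F, (φ i : Cube n).toSet.indicator (fun _ => (1 : ℝ≥0∞)) y := by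
          have : ∀ i : F, (φ i : Cube n).toSet.indicator (fun _ => (1 : ℝ≥0∞)) y = 1 := fun i =>
            indicator_of_mem (hD.cell_mono hn (hF i i.2).1 x hy) _
          simp [this, tsum_fintype]
      _ ≤ overlap A P y := ENNReal.tsum_comp_le_tsum_of_injective hφ fun Q =>
          (Q : Cube n).toSet.indicator (fun _ => (1 : ℝ≥0∞)) y
  rw [Cube.mean, ENNReal.le_div_iff_mul_le (Or.inl (Cube.volume_ne_zero _))
    (Or.inl (Cube.volume_ne_top _)), ← setLIntegral_const]
  exact setLIntegral_mono' (Cube.measurableSet_toSet _) h1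

section

variable {m : ℕ} {g : Fin m → (Fin n → ℝ) → ℝ≥0∞} {A : Set (Cube n)} {L : ℝ≥0∞}
  (s : (Fin n → ℝ) → ℤ) (x : Fin n → ℝ)

theorem mean_overlap_le_of_stopDepth (hAD : A ⊆ D) (hA : IsCarleson D A L) (d : ℕ) :
    (hD.cell (s x - d) x).mean
      (overlap A (hD.cell (s x - hD.stopDepth (Exceeds g A L) s x d) x)) ≤ 4 * L := by
  rcases (hD.stopDepth_le (Exceeds g A L) s x d).lt_or_eq with h | h
  · have := hD.not_of_stopDepth_lt _ s x h
    simp only [Exceeds, not_or, not_lt] at this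
    exact this.2
  · rw [h]
    refine (hA.mean_overlap_le (hD.countable.mono hAD) (hD.cell_mem _ _)).trans ?_
    exact le_mul_of_one_le_left zero_le (by norm_num)

theorem mean_le_of_stopDepth (d : ℕ) (i : Fin m) :
    (hD.cell (s x - d) x).mean (g i) ≤ 4 * (m : ℝ≥0∞) *
      (hD.cell (s x - hD.stopDepth (Exceeds g A L) s x d) x).mean (g i) := by
  rcases (hD.stopDepth_le (Exceeds g A L) s x d).lt_or_eq with h | h
  · have := hD.not_of_stopDepth_lt _ s x h
    simp only [Exceeds, not_or, not_lt, not_exists] at this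
    exact this.1 i
  · rw [h]
    refine le_mul_of_one_le_left zero_le ?_
    have : 1 ≤ m := i.pos
    exact_mod_cast (by omega : 1 ≤ 4 * m)

/-- The depths are split according to whether `a` is still the last stopping depth `k` generations
further down. This is where linear growth in `k` originates. -/
theorem card_stopDepth_eq_le (hn : n ≠ 0) (hAD : A ⊆ D) (hA : IsCarleson D A L) (k a : ℕ)
    (F : Finset ℕ)
    (hF : ∀ d ∈ F, hD.stopDepth (Exceeds g A L) s x d = a ∧ hD.cell (s x - d - k) x ∈ A) :
    (F.card : ℝ≥0∞) ≤ 4 * L + k := by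
  set σ := hD.stopDepth (Exceeds g A L) s x with hσ
  have hmono : Monotone σ := hD.stopDepth_mono _ s x
  rw [← Finset.card_filter_add_card_filter_not (s := F) (p := fun d => σ (d + k) = a), Nat.cast_add]
  refine add_le_add ?_ ?_
  -- At the largest such depth `M` no new stop has occurred down to depth `M + k`. The overlap mean
  -- there is at most `4 * L`, and it counts all descendants belonging to `F₁`.
  · set F₁ := F.filter fun d => σ (d + k) = a
    rcases F₁.eq_empty_or_nonempty with h | hne
    · simp [h]
    obtain ⟨hM, hMa⟩ := Finset.mem_filter.1 (F₁.max'_mem hne)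
    set M := F₁.max' hne
    have hinj : Function.Injective fun d : ℕ => s x - (d : ℤ) - k := fun d e h => by
      simp only at h; omega
    rw [← Finset.card_image_of_injective F₁ hinj]
    have h1 := hD.mean_overlap_le_of_stopDepth (g := g) s x hAD hA (M + k)
    rw [← hσ, hMa] at h1
    refine le_trans ?_ h1
    refine hD.card_le_mean_overlap hn _ fun i hi => ?_
    obtain ⟨d, hd, rfl⟩ := Finset.mem_image.1 hi
    have hdM : d ≤ M := Finset.le_max' _ d hd
    obtain ⟨hdF, -⟩ := Finset.mem_filter.1 hd
    have had : a ≤ d := (hF d hdF).1 ▸ hD.stopDepth_le _ s x d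
    exact ⟨by push_cast; omega, (hF d hdF).2, hD.cell_mono hn (by omega) x⟩
  -- With `N` the smallest such depth, a new stop occurs by depth `N + k`. Depths in `F` still have
  -- last stop `a`, so they lie before `N + k`.
  · set F₂ := F.filter fun d => ¬ σ (d + k) = a
    rcases F₂.eq_empty_or_nonempty with h | hne
    · simp [h]
    set N := F₂.min' hne
    obtain ⟨hN, hNa⟩ := Finset.mem_filter.1 (F₂.min'_mem hne)
    have hsub : F₂ ⊆ Finset.Ico N (N + k) := by
      intro d hd
      obtain ⟨hdF, hda⟩ := Finset.mem_filter.1 hd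
      refine Finset.mem_Ico.2 ⟨Finset.min'_le _ d hd, ?_⟩
      by_contra! hle
      refine hNa (le_antisymm ?_ ?_)
      · exact (hmono hle).trans (hF d hdF).1.le
      · exact (hF N hN).1.ge.trans (hmono (Nat.le_add_right _ _))
    have := Finset.card_le_card hsub
    rw [Nat.card_Ico] at this
    exact_mod_cast (by omega : F₂.card ≤ k)

end

open Classical in
/-- A positive dyadic shift of complexity `k`, restricted to the scales below `s x`, is dominated
by a sparse operator with a constant growing linearly in `k`. -/
theorem exists_sparse_tsum_nat_le (hn : n ≠ 0) {m : ℕ} {p₀ : ℝ} (hp₀ : 0 ≤ p₀)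
    (f : Fin m → (Fin n → ℝ) → ℂ) {A : Set (Cube n)} {L : ℝ≥0∞} (hAD : A ⊆ D)
    (hA : IsCarleson D A L) {s : (Fin n → ℝ) → ℤ}
    (hs : ∀ x, ∀ y ∈ (hD.cell (s x) x).toSet, s y = s x) :
    ∃ S : Set (Cube n), IsSparseFamily S ∧ ∀ (k : ℕ) (x : Fin n → ℝ),
      ∑' d : ℕ, (if hD.cell (s x - d - k) x ∈ A then (hD.cell (s x - d) x).prodAverage p₀ f else 0)
        ≤ ((4 * (m : ℝ≥0∞)) ^ (1 / p₀)) ^ m * (4 * L + k) * sparseA p₀ S f x := by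
  set B := Exceeds (fun i x => ‖f i x‖ₑ ^ p₀) A L with hB
  set c := ((4 * (m : ℝ≥0∞)) ^ (1 / p₀)) ^ m
  refine ⟨hD.stopFamily B s, hD.isSparseFamily_stopFamily B s hn hs fun P hP =>
    hD.volume_biUnion_exceeds_le hn _ hAD hA hP, fun k x => ?_⟩
  -- The terms are grouped by the last stopping cube met.
  let φ : ℕ → hD.stopFamily B s := fun d => ⟨hD.cell (s x - hD.stopDepth B s x d) x, x, d, rfl⟩
  rw [← (Equiv.sigmaFiberEquiv φ).tsum_eq, ENNReal.tsum_sigma', sparseA, ← ENNReal.tsum_mul_left]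
  refine ENNReal.tsum_le_tsum fun P => ?_
  by_cases hP : ∃ d, φ d = P
  swap
  · have : IsEmpty {d // φ d = P} := ⟨fun d => hP ⟨d.1, d.2⟩⟩
    simp
  obtain ⟨d₀, rfl⟩ := hP
  have hx : x ∈ (φ d₀ : Cube n).toSet := hD.mem_cell _ x
  rw [indicator_of_mem hx]
  set w := (φ d₀ : Cube n).prodAverage p₀ f with hw
  change _ ≤ c * (4 * L + k) * w
  have hfib : ∀ d, φ d = φ d₀ → hD.stopDepth B s x d = hD.stopDepth B s x d₀ := fun d hd => by
    have h1 : hD.cell (s x - hD.stopDepth B s x d) x = hD.cell (s x - hD.stopDepth B s x d₀) x :=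
      congrArg Subtype.val hd
    have h2 := hD.cell_injective x h1
    omega
  have hterm : ∀ d : {d // φ d = φ d₀},
      (if hD.cell (s x - (d : ℕ) - k) x ∈ A then (hD.cell (s x - (d : ℕ)) x).prodAverage p₀ f
        else 0) ≤ c * w * (if hD.cell (s x - (d : ℕ) - k) x ∈ A then 1 else 0) := by
    intro d
    split_ifs
    · rw [mul_one]
      refine Cube.prodAverage_le hp₀ f fun i => ?_
      have := hD.mean_le_of_stopDepth (g := fun i x => ‖f i x‖ₑ ^ p₀) (A := A) (L := L) s x d i
      rwa [← hB, hfib d d.2] at this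
    · simp
  calc _ ≤ ∑' d : {d // φ d = φ d₀},
        c * w * (if hD.cell (s x - (d : ℕ) - k) x ∈ A then 1 else 0) :=
        ENNReal.tsum_le_tsum hterm
    _ = c * w * ∑' d : {d // φ d = φ d₀}, (if hD.cell (s x - (d : ℕ) - k) x ∈ A then 1 else 0) :=
        ENNReal.tsum_mul_left
    _ ≤ c * w * (4 * L + k) := by
        gcongr
        rw [ENNReal.tsum_eq_iSup_sum]
        refine iSup_le fun F => ?_
        rw [Finset.sum_boole, ← Finset.card_map (Function.Embedding.subtype _)]
        refine hD.card_stopDepth_eq_le (g := fun i x => ‖f i x‖ₑ ^ p₀) s x hn hAD hA k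
          (hD.stopDepth B s x d₀) _ fun d hd => ?_
        simp only [Finset.mem_map, Finset.mem_filter] at hd
        obtain ⟨e, ⟨-, he⟩, rfl⟩ := hd
        exact ⟨hfib e e.2, he⟩
    _ = c * (4 * L + k) * w := by ring

end IsDyadicGrid

/-! ### Large cubes and sums over all generations -/

namespace IsDyadicGrid

variable {n : ℕ} {D : Set (Cube n)} (hD : IsDyadicGrid D)

-- The grid may split space into several "quadrants", increasing unions of cubes that never meet.
-- One point is chosen in each, and `r x` is the point chosen in the quadrant of `x`.
include hD in
theorem exists_representatives (hn : n ≠ 0) : ∃ r : (Fin n → ℝ) → Fin n → ℝ,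
    (∀ x, ∃ l : ℕ, r x ∈ (hD.cell l x).toSet) ∧
    ∀ j x y, y ∈ (hD.cell j x).toSet → r y = r x := by
  have hcast : ∀ {i j : ℕ}, i ≤ j → ∀ x y, y ∈ (hD.cell i x).toSet → y ∈ (hD.cell j x).toSet :=
    fun hij x y h => hD.cell_mono hn (by exact_mod_cast hij) x h
  let S : Setoid (Fin n → ℝ) :=
    { r := fun x y => ∃ l : ℕ, y ∈ (hD.cell l x).toSet
      iseqv := by
        refine ⟨fun x => ⟨0, hD.mem_cell _ x⟩, ?_, ?_⟩
        · rintro x y ⟨l, hl⟩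
          exact ⟨l, by rw [hD.cell_eq_cell hl]; exact hD.mem_cell _ x⟩
        · rintro x y z ⟨l, hl⟩ ⟨l', hl'⟩
          refine ⟨max l l', ?_⟩
          rw [← hD.cell_eq_cell (hcast (le_max_left l l') x y hl)]
          exact hcast (le_max_right l l') y z hl' }
  refine ⟨fun x => (Quotient.mk S x).out, fun x => ?_, fun j x y hy => ?_⟩
  · exact S.symm (Quotient.mk_out (s := S) x)
  · have : Quotient.mk S y = Quotient.mk S x := Quotient.sound (S.symm
      ⟨j.toNat, hD.cell_mono hn (Int.self_le_toNat j) x hy⟩)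
    simp only [this]

/-- Every dyadic grid contains a sparse family that, over each point `x`, contains all cubes of
generation larger than some `s x`, where `s` is constant on the cubes of generation `s x`. -/
theorem exists_sparse_large_cubes (hn : n ≠ 0) : ∃ (S : Set (Cube n)) (s : (Fin n → ℝ) → ℤ),
    IsSparseFamily S ∧ (∀ x, ∀ y ∈ (hD.cell (s x) x).toSet, s y = s x) ∧
    ∀ x j, s x < j → hD.cell j x ∈ S := by
  classical
  obtain ⟨r, hr, hrc⟩ := hD.exists_representatives hn
  have hrm : ∀ x, ∃ l : ℕ, r x ∈ (hD.cell ((l : ℤ) + 1) x).toSet := fun x => by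
    obtain ⟨l, hl⟩ := hr x
    exact ⟨l, hD.cell_mono hn (by omega) x hl⟩
  -- `N x + 1` is the first generation `≥ 1` at which the cube over `x` contains the representative.
  -- The shift by one makes `N` constant on the cube of generation `N x`.
  obtain ⟨N, hN, hmin⟩ : ∃ N : (Fin n → ℝ) → ℕ, (∀ x, r x ∈ (hD.cell (N x + 1) x).toSet) ∧
      ∀ x, ∀ l < N x, r x ∉ (hD.cell (l + 1) x).toSet :=
    ⟨fun x => Nat.find (hrm x), fun x => Nat.find_spec (hrm x),
      fun x l hl => Nat.find_min (hrm x) hl⟩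
  refine ⟨{Q | ∃ (j : ℤ) (x : Fin n → ℝ), 1 ≤ j ∧ r x ∈ (hD.cell j x).toSet ∧ Q = hD.cell j x},
    fun x => N x, ⟨D, hD, ?_, ?_⟩, ?_, ?_⟩
  · rintro _ ⟨j, x, -, -, rfl⟩
    exact hD.cell_mem j x
  · choose! J hJ using hD.side_eq
    have hJc : ∀ j x, J (hD.cell j x) = j := fun j x => by
      have h1 := hJ _ (hD.cell_mem j x)
      rw [cell_side] at h1
      exact (zpow_right_injective₀ (by norm_num) (by norm_num) h1).symm
    refine ⟨fun Q => {y ∈ Q.toSet | y ∉ (hD.cell (J Q - 1) (r y)).toSet}, ?_, ?_⟩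
    · rintro _ ⟨j, x, -, hx, rfl⟩
      -- The large cubes of one quadrant form a tower around its representative. The set attached to
      -- a cube is the cube minus the next one down the tower, whose volume is at most half.
      have hE : {y ∈ (hD.cell j x).toSet | y ∉ (hD.cell (J (hD.cell j x) - 1) (r y)).toSet}
          = (hD.cell j x).toSet \ (hD.cell (j - 1) (r x)).toSet := by
        ext y
        simp only [mem_ofPred_eq, Set.mem_sdiff, hJc]
        refine and_congr_right fun hy => ?_
        rw [hrc j x y hy]
      have hsub : (hD.cell (j - 1) (r x)).toSet ⊆ (hD.cell j x).toSet := by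
        rw [← hD.cell_eq_cell hx]
        exact hD.cell_mono hn (by omega) _
      beta_reduce
      rw [hE]
      refine ⟨(Cube.measurableSet_toSet _).diff (Cube.measurableSet_toSet _), sdiff_subset, ?_⟩
      rw [measure_sdiff hsub (Cube.measurableSet_toSet _).nullMeasurableSet
        (Cube.volume_ne_top _)]
      have hv : 2 * volume (hD.cell (j - 1) (r x)).toSet ≤ volume (hD.cell j x).toSet := by
        have h2 : ENNReal.ofReal ((2 : ℝ) ^ j) = 2 * ENNReal.ofReal ((2 : ℝ) ^ (j - 1)) := by
          rw [zpow_sub_one₀ (by norm_num), show (2 : ℝ≥0∞) = ENNReal.ofReal 2 by simp,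
            ← ENNReal.ofReal_mul (by norm_num)]
          congr 1; ring
        rw [Cube.volume_toSet, Cube.volume_toSet, cell_side, cell_side, h2, mul_pow]
        gcongr
        exact le_self_pow₀ (by norm_num) hn
      rw [ENNReal.mul_sub (fun _ _ => by norm_num)]
      refine ENNReal.le_sub_of_add_le_left
        (ENNReal.mul_ne_top (by norm_num) (Cube.volume_ne_top _)) ?_
      rw [two_mul (volume (hD.cell j x).toSet)]
      gcongr
    · rintro _ ⟨j, x, -, hx, rfl⟩ _ ⟨i, z, -, hz, rfl⟩ hne
      refine Set.disjoint_left.2 fun y hy hy' => ?_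
      simp only [mem_ofPred_eq, hJc] at hy hy'
      rw [← hD.cell_eq_cell hy.1, ← hD.cell_eq_cell hy'.1] at hne
      have h1 : r y ∈ (hD.cell j y).toSet := by
        rw [hrc j x y hy.1, hD.cell_eq_cell hy.1]; exact hx
      have h2 : r y ∈ (hD.cell i y).toSet := by
        rw [hrc i z y hy'.1, hD.cell_eq_cell hy'.1]; exact hz
      rcases lt_trichotomy i j with h | h | h
      · refine hy.2 (hD.cell_mono hn (show i ≤ j - 1 by omega) _ ?_)
        rw [hD.cell_eq_cell h2]; exact hD.mem_cell i y
      · exact hne (by rw [h])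
      · refine hy'.2 (hD.cell_mono hn (show j ≤ i - 1 by omega) _ ?_)
        rw [hD.cell_eq_cell h1]; exact hD.mem_cell j y
  · intro x y hy
    replace hy : y ∈ (hD.cell (N x) x).toSet := hy
    have hr : r y = r x := hrc _ x y hy
    rw [Nat.cast_inj]
    refine le_antisymm ?_ ?_ <;> by_contra! hlt
    · refine hmin y _ hlt ?_
      rw [hr, hD.cell_eq_cell_of_le hn (by omega) hy]
      exact hN x
    · obtain ⟨q, hq⟩ : ∃ q, N x = q + 1 := ⟨N x - 1, by omega⟩
      refine hmin x q (by omega) ?_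
      rw [hq] at hy
      rw [← hr, ← Nat.cast_add_one, ← hD.cell_eq_cell hy]
      exact hD.cell_mono hn (by omega) y (hN y)
  · intro x j hj
    replace hj : (N x : ℤ) < j := hj
    exact ⟨j, x, by omega, hD.cell_mono hn (by omega) x (hN x), rfl⟩

-- Generations above `s x` give distinct members of `S₁`, with constant `1`; the others are handled
-- by stopping cubes.
open Classical in
theorem exists_sparse_tsum_int_le (hn : n ≠ 0) {m : ℕ} {p₀ : ℝ} (hp₀ : 0 ≤ p₀)
    (f : Fin m → (Fin n → ℝ) → ℂ) {A : Set (Cube n)} {L : ℝ≥0∞} (hAD : A ⊆ D)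
    (hA : IsCarleson D A L) :
    ∃ S₁ S₂ : Set (Cube n), IsSparseFamily S₁ ∧ IsSparseFamily S₂ ∧
      ∀ (k : ℕ) (x : Fin n → ℝ),
      ∑' j : ℤ, (if hD.cell (j - k) x ∈ A then (hD.cell j x).prodAverage p₀ f else 0)
        ≤ sparseA p₀ S₁ f x +
          ((4 * (m : ℝ≥0∞)) ^ (1 / p₀)) ^ m * (4 * L + k) * sparseA p₀ S₂ f x := by
  obtain ⟨S₁, s, hS₁, hs, hbig⟩ := hD.exists_sparse_large_cubes hn
  obtain ⟨S₂, hS₂, hle⟩ := hD.exists_sparse_tsum_nat_le hn hp₀ f hAD hA hs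
  refine ⟨S₁, S₂, hS₁, hS₂, fun k x => ?_⟩
  set F : ℤ → ℝ≥0∞ := fun j =>
    if hD.cell (j - k) x ∈ A then (hD.cell j x).prodAverage p₀ f else 0 with hF
  have hsplit : ∑' j, F j = ∑' d : ℕ, F (s x + 1 + d) + ∑' d : ℕ, F (s x - d) := by
    rw [← (Equiv.addLeft (s x + 1)).tsum_eq F]
    have h1 := (ENNReal.summable (f := fun d : ℕ => F (s x + 1 + d))).hasSum
    have h2 := (ENNReal.summable (f := fun d : ℕ => F (s x - d))).hasSum
    refine (HasSum.of_nat_of_neg_add_one (f := fun j : ℤ => F (s x + 1 + j)) h1 ?_).tsum_eq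
    convert h2 using 3
    ring
  rw [hsplit]
  refine add_le_add ?_ (hle k x)
  let φ : ℕ → S₁ := fun d => ⟨hD.cell (s x + 1 + d) x, hbig x _ (by omega)⟩
  have hφ : Function.Injective φ := fun a b hab => by
    have h1 : hD.cell (s x + 1 + a) x = hD.cell (s x + 1 + b) x := congrArg Subtype.val hab
    have h2 := hD.cell_injective x h1
    omega
  calc ∑' d : ℕ, F (s x + 1 + d)
      ≤ ∑' d : ℕ, (φ d : Cube n).toSet.indicator
          (fun _ => ∏ i, cubeAverage p₀ (φ d : Cube n) (f i)) x := by
        refine ENNReal.tsum_le_tsum fun d => ?_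
        rw [indicator_of_mem (hD.mem_cell _ x)]
        simp only [hF]
        split_ifs
        · exact le_rfl
        · exact zero_le
    _ ≤ sparseA p₀ S₁ f x := ENNReal.tsum_comp_le_tsum_of_injective hφ fun Q : S₁ =>
        (Q : Cube n).toSet.indicator (fun _ => ∏ i, cubeAverage p₀ (Q : Cube n) (f i)) x

end IsDyadicGrid

/-! ### Shifted grids and the one-third trick -/

/-- The offset `± t / 3`, relative to the side length `2 ^ j`, of the `t`-th shifted grid. -/
noncomputable def gridOffset (t : Fin 3) (j : ℤ) : ℝ := (-1) ^ j * ((t : ℕ) : ℝ) / 3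

/-- The cubes with lower corner `2 ^ j (v + (-1) ^ j t / 3)`, `v ∈ ℤⁿ`, and side length `2 ^ j`. -/
def shiftedGrid {n : ℕ} (t : Fin n → Fin 3) : Set (Cube n) :=
  {Q | ∃ (j : ℤ) (v : Fin n → ℤ), Q.side = 2 ^ j ∧
    ∀ i, Q.corner i = 2 ^ j * (v i + gridOffset (t i) j)}

theorem exists_gridOffset_add (t : Fin 3) (j : ℤ) (N : ℕ) (u : ℤ) :
    ∃ u' : ℤ, (2 : ℝ) ^ (j + N) * (u + gridOffset t (j + N)) = 2 ^ j * (u' + gridOffset t j) := by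
  induction N generalizing u with
  | zero => exact ⟨u, by simp⟩
  | succ N ih =>
    obtain ⟨v, hv⟩ : ∃ v : ℤ, (2 : ℝ) ^ (j + N + 1) * (u + gridOffset t (j + N + 1))
        = 2 ^ (j + N) * (v + gridOffset t (j + N)) := by
      -- Doubling `∓ t / 3` gives `± t / 3` up to the integer `t`. The alternating sign in the
      -- offset therefore makes coarse endpoints also fine endpoints.
      rcases Int.even_or_odd (j + N) with h | h
      · refine ⟨2 * u - (t : ℕ), ?_⟩
        rw [gridOffset, gridOffset, h.neg_one_zpow, h.add_one.neg_one_zpow,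
          zpow_add_one₀ (by norm_num)]
        push_cast
        ring
      · refine ⟨2 * u + (t : ℕ), ?_⟩
        rw [gridOffset, gridOffset, h.neg_one_zpow, h.add_one.neg_one_zpow,
          zpow_add_one₀ (by norm_num)]
        push_cast
        ring
    obtain ⟨u', hu'⟩ := ih v
    refine ⟨u', ?_⟩
    rw [← hu', ← hv]
    push_cast
    simp only [add_assoc]

theorem mem_shiftedGrid_interval {t : Fin 3} {j : ℤ} {x : ℝ} {v : ℤ} :
    (2 ^ j * (v + gridOffset t j) ≤ x ∧ x < 2 ^ j * (v + gridOffset t j) + 2 ^ j) ↔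
      ⌊x / 2 ^ j - gridOffset t j⌋ = v := by
  have h2 : (0 : ℝ) < 2 ^ j := by positivity
  rw [Int.floor_eq_iff, le_sub_iff_add_le, le_div_iff₀ h2, sub_lt_iff_lt_add, div_lt_iff₀ h2]
  constructor <;> rintro ⟨h, h'⟩ <;> constructor <;> linarith

theorem isDyadicGrid_shiftedGrid {n : ℕ} (t : Fin n → Fin 3) : IsDyadicGrid (shiftedGrid t) := by
  have key : ∀ Q ∈ shiftedGrid t, ∀ R ∈ shiftedGrid t, Q.side ≤ R.side →
      ¬ Disjoint Q.toSet R.toSet → Q.toSet ⊆ R.toSet := by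
    rintro Q ⟨j, v, hQs, hQc⟩ R ⟨l, u, hRs, hRc⟩ hle hnd
    obtain ⟨z, hzQ, hzR⟩ := Set.not_disjoint_iff.1 hnd
    rw [hQs, hRs, zpow_le_zpow_iff_right₀ (by norm_num)] at hle
    obtain ⟨N, rfl⟩ := Int.le.dest hle
    have h2 : (0 : ℝ) < 2 ^ j := by positivity
    have hN : (2 : ℝ) ^ (j + N) = 2 ^ j * 2 ^ N := by
      rw [zpow_add₀ (by norm_num), zpow_natCast]
    intro x hx i
    obtain ⟨u', hu'⟩ := exists_gridOffset_add (t i) j N (u i)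
    obtain ⟨hx1, hx2⟩ := hx i
    obtain ⟨hz1, hz2⟩ := hzQ i
    obtain ⟨hz3, hz4⟩ := hzR i
    rw [hQc, hQs] at hx2 hz2
    rw [hQc] at hx1 hz1
    rw [hRc, hu'] at hz3 hz4 ⊢
    rw [hRs, hN] at hz4 ⊢
    have h3 : (u' : ℝ) < v i + 1 := by
      have : 2 ^ j * ((u' : ℝ) + gridOffset (t i) j) < 2 ^ j * (v i + 1 + gridOffset (t i) j) := by
        linarith
      linarith [lt_of_mul_lt_mul_left this h2.le]
    have h4 : (v i : ℝ) < u' + 2 ^ N := by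
      have : 2 ^ j * ((v i : ℝ) + gridOffset (t i) j)
          < 2 ^ j * (u' + 2 ^ N + gridOffset (t i) j) := by
        linarith
      linarith [lt_of_mul_lt_mul_left this h2.le]
    -- In units of `2 ^ j` the endpoints differ by integers, so the strict inequalities coming from
    -- the common point `z` improve by a full unit.
    have h5 : (u' : ℝ) ≤ v i := by
      exact_mod_cast Int.lt_add_one_iff.1 (by exact_mod_cast h3)
    have h6 : (v i : ℝ) + 1 ≤ u' + 2 ^ N := by
      have : v i < u' + 2 ^ N := by exact_mod_cast h4
      exact_mod_cast Int.add_one_le_iff.2 this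
    have h7 := mul_le_mul_of_nonneg_left h5 h2.le
    have h8 := mul_le_mul_of_nonneg_left h6 h2.le
    constructor <;> nlinarith
  refine ⟨?_, ?_, ?_⟩
  · rintro Q ⟨j, -, hj, -⟩
    exact ⟨j, hj⟩
  · intro Q hQ R hR
    by_cases hd : Disjoint Q.toSet R.toSet
    · exact Or.inr (Or.inr hd)
    rcases le_total Q.side R.side with h | h
    · exact Or.inl (key Q hQ R hR h hd)
    · exact Or.inr (Or.inl (key R hR Q hQ h fun h' => hd h'.symm))
  · intro j x
    refine ⟨⟨fun i => 2 ^ j * (⌊x i / 2 ^ j - gridOffset (t i) j⌋ + gridOffset (t i) j), 2 ^ j,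
      by positivity⟩, ⟨⟨j, _, rfl, fun _ => rfl⟩, rfl, fun i => ?_⟩, ?_⟩
    · exact mem_shiftedGrid_interval.2 rfl
    · rintro ⟨c, s, hs⟩ ⟨⟨l, v, hl, hc⟩, hj, hx⟩
      simp only at hl hc hj
      subst hl
      obtain rfl : l = j := zpow_right_injective₀ (by norm_num) (by norm_num) hj
      congr 1
      ext i
      have := hx i
      simp only [hc] at this
      rw [mem_shiftedGrid_interval] at this
      rw [hc, this]

/-- Among the three shifts, at most one has an endpoint at scale `j` inside a given interval of
length at most `2 ^ j / 3`. -/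
theorem exists_forall_ne_not_mem_Ioo (j : ℤ) (a L : ℝ) (hL : L ≤ 2 ^ j / 3) :
    ∃ τ : Fin 3, ∀ t ≠ τ, ∀ v : ℤ, ¬ (a < 2 ^ j * (v + gridOffset t j) ∧
      2 ^ j * (v + gridOffset t j) < a + L) := by
  by_contra! h
  obtain ⟨t, -, v, hv1, hv2⟩ := h 0
  obtain ⟨t', hne, v', hv1', hv2'⟩ := h t
  have h2 : (0 : ℝ) < 2 ^ j := by positivity
  -- In units of `2 ^ j / 3` endpoints are integers `3 v ± t`. Two of them in the same short open
  -- interval coincide, and then the shifts agree modulo `3`.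
  have key : ∀ e : ℤ, (-1 : ℝ) ^ j = e → (e = 1 ∨ e = -1) → False := by
    intro e he he1
    rw [gridOffset, he] at hv1 hv2 hv1' hv2'
    have h3 : (2 : ℝ) ^ j * ((3 * v + e * (t : ℕ) : ℤ) : ℝ)
        < 2 ^ j * ((3 * v' + e * (t' : ℕ) + 1 : ℤ) : ℝ) := by
      push_cast; linarith
    have h4 : (2 : ℝ) ^ j * ((3 * v' + e * (t' : ℕ) : ℤ) : ℝ)
        < 2 ^ j * ((3 * v + e * (t : ℕ) + 1 : ℤ) : ℝ) := by
      push_cast; linarith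
    have h5 := Int.cast_lt.1 (lt_of_mul_lt_mul_left h3 h2.le)
    have h6 := Int.cast_lt.1 (lt_of_mul_lt_mul_left h4 h2.le)
    have := t.2
    have := t'.2
    refine hne (Fin.ext ?_)
    rcases he1 with rfl | rfl <;> omega
  rcases Int.even_or_odd j with h | h
  · exact key 1 (by rw [h.neg_one_zpow]; simp) (Or.inl rfl)
  · exact key (-1) (by rw [h.neg_one_zpow]; simp) (Or.inr rfl)

theorem Cube.subset_cell_shiftedGrid {n : ℕ} {t : Fin n → Fin 3} {j : ℤ} {Q : Cube n}
    (h : ∀ i, ∀ v : ℤ, ¬ (Q.corner i < 2 ^ j * (v + gridOffset (t i) j) ∧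
      2 ^ j * (v + gridOffset (t i) j) < Q.corner i + Q.side)) {x : Fin n → ℝ}
    (hx : x ∈ Q.toSet) : Q.toSet ⊆ ((isDyadicGrid_shiftedGrid t).cell j x).toSet := by
  have hD := isDyadicGrid_shiftedGrid t
  obtain ⟨l, v, hs, hc⟩ := hD.cell_mem j x
  have hs' := hD.cell_side j x
  have hxc := hD.mem_cell j x
  obtain rfl : l = j := zpow_right_injective₀ (by norm_num) (by norm_num) (hs.symm.trans hs')
  intro y hy i
  obtain ⟨h1, h2⟩ := hxc i
  obtain ⟨h3, h4⟩ := hx i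
  obtain ⟨h5, h6⟩ := hy i
  rw [hc] at h1 h2 ⊢
  rw [hs'] at h2 ⊢
  have h7 := h i (v i)
  have h8 := h i (v i + 1)
  push_cast at h8
  rw [show (2 : ℝ) ^ l * (v i + 1 + gridOffset (t i) l)
    = 2 ^ l * (v i + gridOffset (t i) l) + 2 ^ l by ring] at h8
  rw [not_and_or, not_lt, not_lt] at h7 h8
  constructor
  · rcases h7 with h | h <;> linarith
  · rcases h8 with h | h <;> linarith

/-- For some shift, both a cube `Q` of side `2 ^ j` and its dilate `2 ^ k Q` lie in cubes of the
shifted grid of four times their side length. -/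
theorem Cube.exists_shiftedGrid {n : ℕ} (k : ℕ) {Q : Cube n} {j : ℤ} (hQ : Q.side = 2 ^ j) :
    ∃ t : Fin n → Fin 3, ∀ x ∈ Q.toSet,
      Q.toSet ⊆ ((isDyadicGrid_shiftedGrid t).cell (j + 2) x).toSet ∧
      (Q.dilate k).toSet ⊆ ((isDyadicGrid_shiftedGrid t).cell (j + 2 + k) x).toSet := by
  have h4 : (2 : ℝ) ^ (j + 2) = 2 ^ j * 4 := by
    rw [zpow_add₀ (by norm_num)]; norm_num
  have hpos : (0 : ℝ) < 2 ^ j := by positivity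
  have hs1 : Q.side ≤ 2 ^ (j + 2) / 3 := by rw [hQ, h4]; linarith
  have hs2 : (Q.dilate k).side ≤ 2 ^ (j + 2 + k) / 3 := by
    have hk : (2 : ℝ) ^ (j + 2 + k) = 2 ^ k * (2 ^ j * 4) := by
      rw [zpow_add₀ (by norm_num), h4, zpow_natCast]; ring
    have : (0 : ℝ) < 2 ^ k * 2 ^ j := by positivity
    rw [Cube.dilate_side, hQ, hk]; linarith
  have : ∀ i, ∃ t : Fin 3, (∀ v : ℤ, ¬ (Q.corner i < 2 ^ (j + 2) * (v + gridOffset t (j + 2)) ∧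
      2 ^ (j + 2) * (v + gridOffset t (j + 2)) < Q.corner i + Q.side)) ∧
      ∀ v : ℤ, ¬ ((Q.dilate k).corner i < 2 ^ (j + 2 + k) * (v + gridOffset t (j + 2 + k)) ∧
      2 ^ (j + 2 + k) * (v + gridOffset t (j + 2 + k))
        < (Q.dilate k).corner i + (Q.dilate k).side) := by
    intro i
    obtain ⟨τ, hτ⟩ := exists_forall_ne_not_mem_Ioo (j + 2) (Q.corner i) Q.side hs1
    obtain ⟨τ', hτ'⟩ := exists_forall_ne_not_mem_Ioo (j + 2 + k) ((Q.dilate k).corner i)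
      (Q.dilate k).side hs2
    -- Each of the two scales excludes at most one of the three shifts, so one shift serves both.
    obtain ⟨t, ht, ht'⟩ : ∃ t : Fin 3, t ≠ τ ∧ t ≠ τ' :=
      (by decide : ∀ τ τ' : Fin 3, ∃ t, t ≠ τ ∧ t ≠ τ') τ τ'
    exact ⟨t, hτ t ht, hτ' t ht'⟩
  choose t ht ht' using this
  exact ⟨t, fun x hx => ⟨Cube.subset_cell_shiftedGrid ht hx,
    Cube.subset_cell_shiftedGrid ht' (Q.subset_dilate k hx)⟩⟩

/-! ### Reduction to dyadic shifts and pointwise domination -/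

/-- The cubes of `D` of four times the side length of a cube of `S` that they contain. -/
def enlargedCubes {n : ℕ} (D S : Set (Cube n)) : Set (Cube n) :=
  {R ∈ D | ∃ Q ∈ S, Q.toSet ⊆ R.toSet ∧ R.side = 4 * Q.side}

/-- Distinct enlarged cubes come from distinct cubes of `S`, whose sparse sets are disjoint and lie
in `P`. The factor `4 ^ n` is the volume ratio and `2` the sparseness constant. -/
theorem IsSparseFamily.isCarleson_enlargedCubes {n : ℕ} {D S : Set (Cube n)}
    (hS : IsSparseFamily S) (hD : IsDyadicGrid D) :
    IsCarleson D (enlargedCubes D S) (2 * 4 ^ n) := by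
  obtain ⟨D₀, -, -, E, hE, hdisj⟩ := hS
  intro P _
  set I := {Q : Cube n | Q ∈ enlargedCubes D S ∧ Q.toSet ⊆ P.toSet} with hI
  have hID : I ⊆ D := fun Q hQ => hQ.1.1
  have : Countable I := (hD.countable.mono hID).to_subtype
  have hq : ∀ R : I, ∃ Q ∈ S, Q.toSet ⊆ (R : Cube n).toSet ∧ (R : Cube n).side = 4 * Q.side :=
    fun R => R.2.1.2
  choose q hqS hqR hqs using hq
  have hinj : Function.Injective q := by
    intro R R' h
    obtain ⟨x, hx⟩ := (q R).nonempty_toSet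
    obtain ⟨j, hj⟩ := hD.side_eq R (hID R.2)
    refine Subtype.ext ?_
    rw [hD.eq_cell (hID R.2) hj (hqR R hx),
      hD.eq_cell (hID R'.2) (by rw [hqs R', ← h, ← hqs R, hj]) (hqR R' (h ▸ hx))]
  have hE' : ∀ R : I, E (q R) ⊆ P.toSet := fun R =>
    ((hE _ (hqS R)).2.1.trans (hqR R)).trans R.2.2
  calc ∑' R : I, volume (R : Cube n).toSet ≤ ∑' R : I, 2 * 4 ^ n * volume (E (q R)) := by
        refine ENNReal.tsum_le_tsum fun R => ?_
        rw [Cube.volume_toSet, hqs R, ENNReal.ofReal_mul (by norm_num), mul_pow,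
          ← Cube.volume_toSet, mul_comm (2 : ℝ≥0∞), mul_assoc]
        norm_num
        gcongr
        exact (hE _ (hqS R)).2.2
    _ = 2 * 4 ^ n * ∑' R : I, volume (E (q R)) := ENNReal.tsum_mul_left
    _ = 2 * 4 ^ n * volume (⋃ R : I, E (q R)) := by
        rw [measure_iUnion (fun R R' hne => hdisj (hqS R) (hqS R') (hinj.ne hne))
          fun R => (hE _ (hqS R)).1]
    _ ≤ 2 * 4 ^ n * volume P.toSet := by
        gcongr
        exact iUnion_subset hE'

open Classical in
theorem IsSparseFamily.sparseT_le {n m : ℕ} {p₀ : ℝ} (hp₀ : 0 ≤ p₀) {S : Set (Cube n)}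
    (hS : IsSparseFamily S) (k : ℕ) (f : Fin m → (Fin n → ℝ) → ℂ) (x : Fin n → ℝ) :
    sparseT k p₀ S f x ≤ (((4 : ℝ≥0∞) ^ n) ^ (1 / p₀)) ^ m * ∑ t : Fin n → Fin 3, ∑' j : ℤ,
      (if (isDyadicGrid_shiftedGrid t).cell (j - k) x ∈ enlargedCubes (shiftedGrid t) S then
        ((isDyadicGrid_shiftedGrid t).cell j x).prodAverage p₀ f else 0) := by
  obtain ⟨D, hD, hSD, -⟩ := hS
  set c := (((4 : ℝ≥0∞) ^ n) ^ (1 / p₀)) ^ m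
  set G : (Fin n → Fin 3) → ℤ → ℝ≥0∞ := fun t j =>
    if (isDyadicGrid_shiftedGrid t).cell (j - k) x ∈ enlargedCubes (shiftedGrid t) S then
      ((isDyadicGrid_shiftedGrid t).cell j x).prodAverage p₀ f else 0 with hG
  set T : Set (Cube n) := {Q | Q ∈ S ∧ x ∈ Q.toSet} with hT
  have h1 : sparseT k p₀ S f x = ∑' Q : T, ((Q : Cube n).dilate k).prodAverage p₀ f := by
    rw [sparseT, tsum_subtype S fun Q : Cube n => Q.toSet.indicator
      (fun _ => ∏ i, cubeAverage p₀ (Q.dilate k) (f i)) x,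
      tsum_subtype T fun Q : Cube n => (Q.dilate k).prodAverage p₀ f]
    refine tsum_congr fun Q => ?_
    by_cases hQ : Q ∈ S <;> by_cases hx : x ∈ Q.toSet <;>
      simp [indicator, hT, hQ, hx, Cube.prodAverage]
  have hJ : ∀ Q : T, ∃ j, (Q : Cube n) = hD.cell j x := fun Q =>
    hD.exists_eq_cell (hSD Q.2.1) Q.2.2
  choose J hJ using hJ
  -- Cubes of `S` over `x` lie in a single grid and so have different generations: each `j` is used
  -- at most once.
  have hJinj : Function.Injective fun Q : T => J Q + 2 + k := fun Q R h => by
    have : J Q = J R := by simpa using h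
    exact Subtype.ext (by rw [hJ Q, hJ R, this])
  have hterm : ∀ Q : T, ((Q : Cube n).dilate k).prodAverage p₀ f
      ≤ c * ∑ t, G t (J Q + 2 + k) := by
    intro Q
    have hs : (Q : Cube n).side = 2 ^ J Q := by rw [hJ Q, hD.cell_side]
    obtain ⟨t, ht⟩ := Cube.exists_shiftedGrid k hs
    obtain ⟨hsub, hsub'⟩ := ht x Q.2.2
    have hD' := isDyadicGrid_shiftedGrid t
    have hmem : hD'.cell (J Q + 2 + k - k) x ∈ enlargedCubes (shiftedGrid t) S := by
      rw [add_sub_cancel_right]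
      refine ⟨hD'.cell_mem _ _, Q, Q.2.1, hsub, ?_⟩
      rw [hD'.cell_side, hs, zpow_add₀ (by norm_num)]
      norm_num [mul_comm]
    calc ((Q : Cube n).dilate k).prodAverage p₀ f
        ≤ c * (hD'.cell (J Q + 2 + k) x).prodAverage p₀ f := by
          refine Cube.prodAverage_le hp₀ f fun i => ?_
          refine (Cube.mean_le_mean_of_subset hsub' (by norm_num : (0 : ℝ) < 4) ?_).trans_eq
            (by norm_num)
          rw [hD'.cell_side, Cube.dilate_side, hs, zpow_add₀ (by norm_num), zpow_add₀ (by norm_num),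
            zpow_natCast]
          norm_num
          ring
      _ = c * G t (J Q + 2 + k) := by simp only [hG]; rw [if_pos hmem]
      _ ≤ c * ∑ t, G t (J Q + 2 + k) := by
          gcongr
          exact Finset.single_le_sum (f := fun t => G t (J Q + 2 + k)) (fun _ _ => zero_le)
            (Finset.mem_univ t)
  calc sparseT k p₀ S f x ≤ ∑' Q : T, c * ∑ t, G t (J Q + 2 + k) :=
        h1.trans_le (ENNReal.tsum_le_tsum hterm)
    _ ≤ ∑' j : ℤ, c * ∑ t, G t j :=
        ENNReal.tsum_comp_le_tsum_of_injective hJinj fun j => c * ∑ t, G t j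
    _ = c * ∑ t, ∑' j : ℤ, G t j := by
        rw [ENNReal.tsum_mul_left, Summable.tsum_finsetSum fun _ _ => ENNReal.summable]

/-- Pointwise domination of `sparseT` by finitely many operators `sparseA`, with a constant that
is linear in `k`. -/
theorem exists_forall_sparseT_le_sum_sparseA (n m : ℕ) (hn : n ≠ 0) {p₀ : ℝ} (hp₀ : 0 ≤ p₀) :
    ∃ M : ℝ≥0, ∀ (k : ℕ) (S : Set (Cube n)), IsSparseFamily S →
      ∀ f : Fin m → (Fin n → ℝ) → ℂ, ∃ S' : (Fin n → Fin 3) × Bool → Set (Cube n),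
        (∀ b, IsSparseFamily (S' b)) ∧ ∀ x, sparseT k p₀ S f x
          ≤ (M * (k + 1) : ℝ≥0) * ∑ b, sparseA p₀ (S' b) f x := by
  have hp : 0 ≤ 1 / p₀ := by positivity
  set c : ℝ≥0∞ := (((4 : ℝ≥0∞) ^ n) ^ (1 / p₀)) ^ m with hc
  set c' : ℝ≥0∞ := ((4 * (m : ℝ≥0∞)) ^ (1 / p₀)) ^ m with hc'
  have hct : c ≠ ∞ := ENNReal.pow_ne_top (ENNReal.rpow_ne_top_of_nonneg hp
    (ENNReal.pow_ne_top (by norm_num)))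
  have hct' : c' ≠ ∞ := ENNReal.pow_ne_top (ENNReal.rpow_ne_top_of_nonneg hp
    (ENNReal.mul_ne_top (by norm_num) (ENNReal.natCast_ne_top m)))
  set L : ℝ≥0∞ := 2 * 4 ^ n with hL
  have hLt : L ≠ ∞ := ENNReal.mul_ne_top (by norm_num) (ENNReal.pow_ne_top (by norm_num))
  set N : ℝ≥0∞ := 1 + c' * (4 * L + 1) with hN
  have hNt : N ≠ ∞ := ENNReal.add_ne_top.2 ⟨by norm_num, ENNReal.mul_ne_top hct'
    (ENNReal.add_ne_top.2 ⟨ENNReal.mul_ne_top (by norm_num) hLt, by norm_num⟩)⟩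
  refine ⟨(c * N).toNNReal, fun k S hS f => ?_⟩
  have hex := fun t : Fin n → Fin 3 =>
    (isDyadicGrid_shiftedGrid t).exists_sparse_tsum_int_le hn hp₀ f
      (A := enlargedCubes (shiftedGrid t) S) (sep_subset _ _)
      (hS.isCarleson_enlargedCubes (isDyadicGrid_shiftedGrid t))
  choose S₁ S₂ hS₁ hS₂ hle using hex
  refine ⟨fun b => cond b.2 (S₁ b.1) (S₂ b.1), ?_, fun x => ?_⟩
  · rintro ⟨t, b⟩
    cases b
    · exact hS₂ t
    · exact hS₁ t
  -- `N` is chosen so that `N * (k + 1)` absorbs both constants of `exists_sparse_tsum_int_le`.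
  have h1 : (1 : ℝ≥0∞) ≤ N * (k + 1) :=
    one_le_mul le_self_add le_add_self
  have h2 : c' * (4 * L + k) ≤ N * (k + 1) := by
    calc c' * (4 * L + k) ≤ c' * ((4 * L + 1) * (k + 1)) := by
          gcongr
          calc 4 * L + k ≤ 4 * L + k + (4 * L * k + 1) := le_self_add
            _ = (4 * L + 1) * (k + 1) := by ring
      _ = c' * (4 * L + 1) * (k + 1) := by ring
      _ ≤ N * (k + 1) := by gcongr; exact le_add_self
  rw [Fintype.sum_prod_type]
  calc sparseT k p₀ S f x ≤ _ := hS.sparseT_le hp₀ k f x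
    _ ≤ c * ∑ t, (N * (k + 1) * sparseA p₀ (S₁ t) f x + N * (k + 1) * sparseA p₀ (S₂ t) f x) := by
        gcongr with t
        refine (hle t k x).trans (add_le_add ?_ ?_)
        · exact le_mul_of_one_le_left zero_le h1
        · gcongr
    _ = _ := by
        rw [ENNReal.coe_mul, ENNReal.coe_toNNReal (ENNReal.mul_ne_top hct hNt)]
        simp only [Fintype.sum_bool, cond_true, cond_false, Finset.mul_sum]
        refine Finset.sum_congr rfl fun t _ => ?_
        push_cast
        ring

/-! ### Passage to the quasi-norm -/

namespace QuasiBanachFunctionSpace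

variable {n : ℕ} (X : QuasiBanachFunctionSpace n)

/-- Each added term costs a factor `K`; it is replaced by `K + 1`, whose powers are at least `1`, so
that the new term can share the constant of the earlier ones. -/
theorem qnorm_sum_le {K : ℝ≥0} (hK : ∀ g h, Measurable g → Measurable h →
    X.qnorm (fun x => g x + h x) ≤ K * (X.qnorm g + X.qnorm h)) {ι : Type*} (s : Finset ι)
    (g : ι → (Fin n → ℝ) → ℝ≥0∞) (hg : ∀ i, Measurable (g i)) :
    X.qnorm (fun x => ∑ i ∈ s, g i x) ≤ ((K + 1) ^ s.card : ℝ≥0) * ∑ i ∈ s, X.qnorm (g i) := by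
  classical
  induction s using Finset.induction_on with
  | empty =>
    have : X.qnorm (fun _ => 0) = 0 := (X.qnorm_eq_zero_iff _ measurable_const).2 ae_eq_rfl
    simp [this]
  | insert a s ha ih =>
    simp only [Finset.sum_insert ha, Finset.card_insert_of_notMem ha]
    have h1 : (1 : ℝ≥0∞) ≤ ((K + 1) ^ s.card : ℝ≥0) := by
      exact_mod_cast one_le_pow₀ (le_add_self : (1 : ℝ≥0) ≤ K + 1)
    calc X.qnorm (fun x => g a x + ∑ i ∈ s, g i x)
        ≤ K * (X.qnorm (g a) + X.qnorm fun x => ∑ i ∈ s, g i x) :=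
          hK _ _ (hg a) (Finset.measurable_sum s fun i _ => hg i)
      _ ≤ ((K + 1 : ℝ≥0) : ℝ≥0∞) * (((K + 1) ^ s.card : ℝ≥0) * X.qnorm (g a)
            + ((K + 1) ^ s.card : ℝ≥0) * ∑ i ∈ s, X.qnorm (g i)) := by
          gcongr
          · exact le_self_add
          · exact le_mul_of_one_le_left zero_le h1
      _ = _ := by
          rw [pow_succ, ENNReal.coe_mul]
          ring

end QuasiBanachFunctionSpace

theorem theoremA (n m : ℕ) (hn : 1 ≤ n) (hm : 1 ≤ m) (p₀ : ℝ) (hp₀ : 1 ≤ p₀)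
    (X : QuasiBanachFunctionSpace n) :
    ∃ C : ℝ, 0 < C ∧
      ∀ (k : ℕ) (S : Set (Cube n)), IsSparseFamily S →
        ∀ f : Fin m → (Fin n → ℝ) → ℂ, (∀ i, AEMeasurable (f i) volume) →
          ∃ S' : Set (Cube n), IsSparseFamily S' ∧
            X.qnorm (sparseT k p₀ S f)
              ≤ ENNReal.ofReal (C * ((k : ℝ) + 1)) * X.qnorm (sparseA p₀ S' f) := by
  obtain ⟨K, hK⟩ := X.qnorm_add_le
  obtain ⟨M, hM⟩ := exists_forall_sparseT_le_sum_sparseA n m (by omega : n ≠ 0)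
    (zero_le_one.trans hp₀)
  set N : ℕ := Fintype.card ((Fin n → Fin 3) × Bool)
  set C : ℝ≥0 := M * (K + 1) ^ N * N + 1 with hC
  refine ⟨C, by positivity, fun k S hS f _ => ?_⟩
  obtain ⟨S', hS', hle⟩ := hM k S hS f
  -- The sum of the `N` quasi-norms is at most `N` times the largest, so a single sparse family
  -- suffices. This is why it depends on `f` and `X`.
  obtain ⟨b, -, hb⟩ := Finset.exists_max_image Finset.univ
    (fun b => X.qnorm (sparseA p₀ (S' b) f)) ⟨(0, true), Finset.mem_univ _⟩
  have hmeas : ∀ b, Measurable (sparseA p₀ (S' b) f) := fun b =>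
    measurable_tsum_indicator (hS' b).countable fun Q => ∏ i, cubeAverage p₀ Q (f i)
  have hmeasT : Measurable (sparseT k p₀ S f) :=
    measurable_tsum_indicator hS.countable fun Q => ∏ i, cubeAverage p₀ (Q.dilate k) (f i)
  have hmeasS : Measurable fun x => ∑ b, sparseA p₀ (S' b) f x :=
    Finset.measurable_sum _ fun b _ => hmeas b
  refine ⟨S' b, hS' b, ?_⟩
  calc X.qnorm (sparseT k p₀ S f)
      ≤ X.qnorm (fun x => (M * (k + 1) : ℝ≥0) * ∑ b, sparseA p₀ (S' b) f x) :=
        X.qnorm_mono _ _ hmeasT (hmeasS.const_mul _) (ae_of_all _ hle)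
    _ = (M * (k + 1) : ℝ≥0) * X.qnorm (fun x => ∑ b, sparseA p₀ (S' b) f x) :=
        X.qnorm_const_mul _ _ hmeasS
    _ ≤ (M * (k + 1) : ℝ≥0) *
          (((K + 1) ^ N : ℝ≥0) * ∑ b, X.qnorm (sparseA p₀ (S' b) f)) := by
        gcongr
        exact X.qnorm_sum_le hK Finset.univ _ hmeas
    _ ≤ (M * (k + 1) : ℝ≥0) *
          (((K + 1) ^ N : ℝ≥0) * ((N : ℝ≥0) * X.qnorm (sparseA p₀ (S' b) f))) := by
        gcongr
        refine (Finset.sum_le_card_nsmul _ _ _ hb).trans_eq ?_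
        rw [nsmul_eq_mul]
        rfl
    _ = (M * (K + 1) ^ N * N * (k + 1) : ℝ≥0) * X.qnorm (sparseA p₀ (S' b) f) := by
        push_cast
        ring
    _ ≤ ENNReal.ofReal (C * ((k : ℝ) + 1)) * X.qnorm (sparseA p₀ (S' b) f) := by
        gcongr
        rw [show (C : ℝ) * ((k : ℝ) + 1) = ((C * (k + 1) : ℝ≥0) : ℝ) by push_cast; ring,
          ENNReal.ofReal_coe_nnreal, ENNReal.coe_le_coe]
        gcongr
        exact le_self_add
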